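/- \textbf{Setting.} Let $\mathcal D\subset\mathbb R$ be measurable and let $(W_u)_{u\in L_2(\mathcal D)}$ be a centered Gaussian process with $\mathbb E[W_uW_{u'}]=\int_{\mathcal D}u(t)u'(t)\,dt$. For an unknown $s\in L_2(\mathcal D)$ and $n\in\mathbb N^*=\{1,2,\dots\}$ one observes $Y_n(u)=\int_{\mathcal D}u(t)s(t)\,dt+\frac1{\sqrt n}W_u$, $u\in L_2(\mathcal D)$. Let $\Phi=(\varphi_i)_{i\in\mathcal I}$ be a countable family in $L_2(\mathcal D)$. For each $n\ge1$ let $\mathcal M_n$ be a collection of models, i.e. of finite-dimensional subspaces $m=\mathrm{span}\{\varphi_i:\ i\in\mathcal I_m\}$, $\mathcal I_m\subset\mathcal I$. Put $D_m=\dim m$, let $s_m$ be the orthogonal projection of $s$ onto $m$, and let $\hat s_m=\sum_{i=1}^{D_m}Y_n(e_i^m)e_i^m$, where $(e_i^m)_{i\le D_m}$ is an orthonormal basis of $m$; $\hat s_m$ minimizes over $u\in m$ the contrast $\gamma_n(u)=-2Y_n(u)+\|u\|^2$. Let $(\lambda_n)_{n\ge1}$ be positive numbers, and for every $n\ge1$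 let $\hat m$ be, almost surely, a minimizer over $m\in\mathcal M_n$ of $\gamma_n(\hat s_m)+\frac{\lambda_n}{n}D_m$. Set \[ Q(s,n)=\inf_{m\in\mathcal M_n}\Big\{\|s_m-s\|^2+\frac{\lambda_n}{n}D_m\Big\},\qquad \rho_{n,\alpha}=\Big(\frac{\lambda_n}{n}\Big)^{\frac{\alpha}{1+2\alpha}}. \] \textbf{Theorem.} Let $0<\alpha_0<\infty$. Assume that $\mathcal M_n\subset\mathcal M_{n+1}$ for all $n\ge1$, that $(\lambda_n)_n$ is non-decreasing with $\lim_{n\to\infty}\lambda_n/n=0$, and that there are $n_0\in\mathbb N^*$, $0<\delta\le\frac12$ and $0<p<1$ such that for all $n\ge n_0$ \[ \lambda_{2n}\le 2(1-\delta)\lambda_n,\qquad \sum_{m\in\mathcal M_n}e^{-\frac{(\sqrt{\lambda_n}-1)^2D_m}{2}}\le\sqrt{1-p}, \] and that $\lambda_{n_0}\ge\Upsilon(\delta,p,\alpha_0)$, where \[ \Upsilon(\delta,p,\alpha_0)=\frac{8}{p\,g}\Big(\frac{16}{g}+1\Big),\qquad g=g(\delta,\alpha_0)=(1-\delta)^{\frac{2\alpha_0}{2\alpha_0+1}}-1+\delta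 . \] Then for every $\alpha\in(0,\alpha_0]$ and every $R>0$ there exists $R'>0$ such that for all $s\in L_2(\mathcal D)$ \[ \sup_{n\ge1}\Big\{\rho_{n,\alpha}^{-2}\,\mathbb E\big[\|\hat s_{\hat m}-s\|^2\big]\Big\}\le R^2\quad\Longrightarrow\quad \sup_{n\ge1}\Big\{\rho_{n,\alpha}^{-2}\,Q(s,n)\Big\}\le (R')^2 . \] -/

import Mathlib

open MeasureTheory ProbabilityTheory Filter Topology
open scoped ENNReal InnerProductSpace

noncomputable section

namespace WhiteNoise

/-- The space of square integrable real functions on the domain `𝒟 ⊆ ℝ` (Lebesgue measure). -/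
abbrev L2 (𝒟 : Set ℝ) : Type := Lp ℝ 2 (volume.restrict 𝒟)

/-- `W` is the Gaussian white noise (isonormal process) on `L²(𝒟)`: a centered Gaussian process
indexed by `u ∈ L²(𝒟)`, with `𝔼[W_u W_v] = ∫ u v`. -/
structure IsWhiteNoise {𝒟 : Set ℝ} {Ω : Type*} [MeasurableSpace Ω]
    (W : L2 𝒟 → Ω → ℝ) (P : Measure Ω) : Prop where
  isGaussianProcess : IsGaussianProcess W P
  centered : ∀ u, ∫ ω, W u ω ∂P = 0
  covariance : ∀ u v, ∫ ω, W u ω * W v ω ∂P = ∫ t in 𝒟, u t * v t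

/-- The observations `Y_n(u) = ∫ u s + n^{-1/2} W_u`. -/
def observation {𝒟 : Set ℝ} {Ω : Type*} (W : L2 𝒟 → Ω → ℝ) (s : L2 𝒟) (n : ℕ)
    (u : L2 𝒟) (ω : Ω) : ℝ :=
  (∫ t in 𝒟, u t * s t) + (1 / √(n : ℝ)) * W u ω

/-- A model: a finite-dimensional subspace of `L²(𝒟)` spanned by some of the functions of the
dictionary `Φ`. Two models are equal iff the subspaces are. -/
structure Model {𝒟 : Set ℝ} {ι : Type*} (Φ : ι → L2 𝒟) where
  space : Submodule ℝ (L2 𝒟)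
  exists_index : ∃ I : Set ι, space = Submodule.span ℝ (Φ '' I)
  finiteDimensional : FiniteDimensional ℝ space

namespace Model

variable {𝒟 : Set ℝ} {ι : Type*} {Φ : ι → L2 𝒟}

instance instFiniteDimensional (m : Model Φ) : FiniteDimensional ℝ m.space := m.finiteDimensional

/-- The dimension `D_m`. -/
def dim (m : Model Φ) : ℕ := Module.finrank ℝ m.space

/-- The orthogonal projection `s_m` of `s` onto `m`. -/
def proj (m : Model Φ) (s : L2 𝒟) : L2 𝒟 := m.space.starProjection s

end Model

/-- A choice of an orthonormal basis `e^m_1, …, e^m_{D_m}` for every model `m`. -/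
abbrev BasisChoice {𝒟 : Set ℝ} {ι : Type*} (Φ : ι → L2 𝒟) : Type _ :=
  ∀ m : Model Φ, OrthonormalBasis (Fin m.dim) ℝ m.space

section Procedure

variable {𝒟 : Set ℝ} {ι : Type*} {Φ : ι → L2 𝒟} {Ω : Type*}

/-- The empirical contrast `γ_n(u) = -2 Y_n(u) + ‖u‖²` of a function `u ∈ m`. Since the process
`Y_n` is determined, and linear, only up to null sets for each `u`, its values on the
finite-dimensional space `m` are computed from those on the orthonormal basis of `m`:
`Y_n(∑ cᵢ eᵢ) = ∑ cᵢ Y_n(eᵢ)`. -/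
def contrast (W : L2 𝒟 → Ω → ℝ) (e : BasisChoice Φ) (s : L2 𝒟) (n : ℕ)
    (m : Model Φ) (u : m.space) (ω : Ω) : ℝ :=
  -2 * (∑ i, ⟪e m i, u⟫_ℝ * observation W s n (e m i : L2 𝒟) ω) + ‖u‖ ^ 2

/-- The estimator on the model `m`, i.e. the projection of the data onto `m`:
`ŝ_m = ∑ᵢ Y_n(eᵢ) eᵢ`. See `contrast_estimator_le`: it minimizes the contrast over `m`. -/
def estimator (W : L2 𝒟 → Ω → ℝ) (e : BasisChoice Φ) (s : L2 𝒟) (n : ℕ)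
    (m : Model Φ) (ω : Ω) : m.space :=
  ∑ i, observation W s n (e m i : L2 𝒟) ω • e m i

theorem contrast_eq (W : L2 𝒟 → Ω → ℝ) (e : BasisChoice Φ) (s : L2 𝒟) (n : ℕ)
    (m : Model Φ) (u : m.space) (ω : Ω) :
    contrast W e s n m u ω =
      ‖u - estimator W e s n m ω‖ ^ 2 - ‖estimator W e s n m ω‖ ^ 2 := by
  have h : ⟪u, estimator W e s n m ω⟫_ℝ =
      ∑ i, ⟪e m i, u⟫_ℝ * observation W s n (e m i : L2 𝒟) ω := by
    unfold estimator
    rw [inner_sum]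
    refine Finset.sum_congr rfl fun i _ => ?_
    have h1 := real_inner_smul_right u (e m i) (observation W s n (e m i : L2 𝒟) ω)
    have h2 := real_inner_comm u (e m i)
    refine h1.trans ?_
    rw [← h2, mul_comm]
  rw [norm_sub_sq_real, h]
  unfold contrast
  ring

/-- `ŝ_m` minimizes the empirical contrast over `m`. -/
theorem contrast_estimator_le (W : L2 𝒟 → Ω → ℝ) (e : BasisChoice Φ) (s : L2 𝒟) (n : ℕ)
    (m : Model Φ) (u : m.space) (ω : Ω) :
    contrast W e s n m (estimator W e s n m ω) ω ≤ contrast W e s n m u ω := by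
  rw [contrast_eq, contrast_eq, sub_self, norm_zero]
  nlinarith [sq_nonneg ‖u - estimator W e s n m ω‖]

/-- The penalized criterion `γ_n(ŝ_m) + (λ_n / n) D_m`. -/
def criterion (lam : ℕ → ℝ) (W : L2 𝒟 → Ω → ℝ) (e : BasisChoice Φ) (s : L2 𝒟) (n : ℕ)
    (m : Model Φ) (ω : Ω) : ℝ :=
  contrast W e s n m (estimator W e s n m ω) ω + lam n / n * m.dim

/-- `mhat` is the penalized model selection rule for the signal `s`: for every `n ≥ 1`, almost
surely, `mhat n` is a minimizer of the penalized criterion over the collection `M n`. -/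
def IsSelection [MeasurableSpace Ω] (P : Measure Ω) (M : ℕ → Set (Model Φ)) (lam : ℕ → ℝ)
    (W : L2 𝒟 → Ω → ℝ) (e : BasisChoice Φ) (s : L2 𝒟) (mhat : ℕ → Ω → Model Φ) : Prop :=
  ∀ n, 1 ≤ n → ∀ᵐ ω ∂P, mhat n ω ∈ M n ∧
    ∀ m ∈ M n, criterion lam W e s n (mhat n ω) ω ≤ criterion lam W e s n m ω

/-- The quadratic risk `𝔼 ‖ŝ_{m̂} - s‖²`, as an element of `[0, ∞]`. -/
def risk [MeasurableSpace Ω] (P : Measure Ω) (W : L2 𝒟 → Ω → ℝ) (e : BasisChoice Φ)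
    (s : L2 𝒟) (mhat : ℕ → Ω → Model Φ) (n : ℕ) : ℝ≥0∞ :=
  ∫⁻ ω, ENNReal.ofReal (‖(estimator W e s n (mhat n ω) ω : L2 𝒟) - s‖ ^ 2) ∂P

/-- `Q(s, n) = inf_{m ∈ M_n} {‖s_m - s‖² + (λ_n / n) D_m}`, as an element of `[0, ∞]`. -/
def Q (M : ℕ → Set (Model Φ)) (lam : ℕ → ℝ) (s : L2 𝒟) (n : ℕ) : ℝ≥0∞ :=
  ⨅ m ∈ M n, ENNReal.ofReal (‖m.proj s - s‖ ^ 2 + lam n / n * m.dim)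

end Procedure

/-- The rate `ρ_{n,α} = (λ_n / n)^{α / (1 + 2α)}`. -/
def rate (lam : ℕ → ℝ) (α : ℝ) (n : ℕ) : ℝ := (lam n / n) ^ (α / (1 + 2 * α))

/-- `sup_{n ≥ 1} ρ_{n,α}^{-2} a_n`, as an element of `[0, ∞]`. -/
def scaledSup (lam : ℕ → ℝ) (α : ℝ) (a : ℕ → ℝ≥0∞) : ℝ≥0∞ :=
  ⨆ (n : ℕ) (_ : 1 ≤ n), ENNReal.ofReal ((rate lam α n ^ 2)⁻¹) * a n

/-- `g(δ, α₀) = (1 - δ)^{2α₀ / (2α₀ + 1)} - 1 + δ`. -/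
def gConst (δ α₀ : ℝ) : ℝ := (1 - δ) ^ (2 * α₀ / (2 * α₀ + 1)) - 1 + δ

/-- `Υ(δ, p, α₀) = 8 / (p g) * (16 / g + 1)` with `g = g(δ, α₀)`. -/
def upsilon (δ p α₀ : ℝ) : ℝ := 8 / (p * gConst δ α₀) * (16 / gConst δ α₀ + 1)

end WhiteNoise

end

/-! A small risk should force small approximation error; the obstacle is the penalty, since the risk
controls the bias of the selected model directly but not `lam n / n` times its dimension. The remedy
is a recursion over n, 2n, 4n, ...

At size n, some outcome ω outside an exceptional event has loss at most a multiple of the squared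
rate (`IsSelection.exists_loss_le`); everything afterwards is deterministic at that ω. Comparing the
criterion of the selected model with that of a good model m₀ shows that its penalty is at most
(1+ε)/(1-ε) times the penalized bias of m₀, plus terms of the order of the squared rate
(`IsSelection.exists_dim_le`). Used at size 2n, the selected model has the same bias, while its
penalty is multiplied by x = λ_{2n}/(2λ_n) ≤ 1-δ. The squared rate is multiplied only by x^β with β
= 2α/(1+2α) < 1, so a factor x^{1-β} < 1 is gained and, for small ε, the bound reproduces itself
with the same constant K (`mul_add_le_mul_rpow`).

The recursion needs a start that is uniform in s. It comes from small deviations of χ² variables: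
the noise energy in the selected model is at least a multiple of its dimension, so the risk up to
size n₀ bounds that dimension (`IsSelection.exists_bias_add_variance_le`). Monotonicity fills the
gaps between dyadic sizes. -/

namespace WhiteNoise

/-! ### Almost sure linearity and deviation bounds of the white noise. -/

section Noise

variable {𝒟 : Set ℝ} {Ω : Type*} [MeasurableSpace Ω] {P : Measure Ω} {W : L2 𝒟 → Ω → ℝ}

theorem setIntegral_mul_eq_inner (u v : L2 𝒟) : ∫ t in 𝒟, u t * v t = ⟪u, v⟫_ℝ := by
  rw [L2.inner_def]
  refine integral_congr_ae (Eventually.of_forall fun t => ?_)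
  simp [mul_comm]

namespace IsWhiteNoise

theorem memLp (hW : IsWhiteNoise W P) (u : L2 𝒟) : MemLp (W u) 2 P :=
  (hW.isGaussianProcess.hasGaussianLaw_eval u).memLp_two

theorem integral_mul (hW : IsWhiteNoise W P) (u v : L2 𝒟) :
    ∫ ω, W u ω * W v ω ∂P = ⟪u, v⟫_ℝ := by
  rw [hW.covariance, setIntegral_mul_eq_inner]

theorem covariance_eq (hW : IsWhiteNoise W P) (u v : L2 𝒟) :
    cov[W u, W v; P] = ⟪u, v⟫_ℝ := by
  have := hW.isGaussianProcess.isProbabilityMeasure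
  rw [covariance_eq_sub (hW.memLp u) (hW.memLp v), hW.centered, hW.centered, ← hW.integral_mul]
  simp

theorem map_eq_gaussianReal (hW : IsWhiteNoise W P) (u : L2 𝒟) :
    P.map (W u) = gaussianReal 0 (‖u‖ ^ 2).toNNReal := by
  rw [(hW.isGaussianProcess.hasGaussianLaw_eval u).map_eq_gaussianReal, hW.centered,
    ← covariance_self (hW.memLp u).aemeasurable, hW.covariance_eq, real_inner_self_eq_norm_sq]

/-- The covariance is bilinear, so the defect X is orthogonal in L²(P) to every W x; being itself a
combination of such variables, it has zero second moment. -/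
theorem ae_linear_comb (hW : IsWhiteNoise W P) (a b : ℝ) (u v : L2 𝒟) :
    W (a • u + b • v) =ᵐ[P] fun ω => a * W u ω + b * W v ω := by
  set w := a • u + b • v with hw
  set X : Ω → ℝ := fun ω => W w ω - (a * W u ω + b * W v ω) with hX
  have hXm : MemLp X 2 P :=
    (hW.memLp w).sub (((hW.memLp u).const_mul a).add ((hW.memLp v).const_mul b))
  have key : ∀ x : L2 𝒟, ∫ ω, W x ω * X ω ∂P = 0 := by
    intro x
    have hi : ∀ y : L2 𝒟, Integrable (fun ω => W x ω * W y ω) P := fun y =>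
      (hW.memLp x).integrable_mul (hW.memLp y)
    have h : (fun ω => W x ω * X ω) = fun ω =>
        W x ω * W w ω - (a * (W x ω * W u ω) + b * (W x ω * W v ω)) := by
      funext ω; simp only [hX]; ring
    rw [h, integral_sub (hi w) (by exact ((hi u).const_mul a).add ((hi v).const_mul b)),
      integral_add ((hi u).const_mul a) ((hi v).const_mul b), integral_const_mul,
      integral_const_mul, hW.integral_mul, hW.integral_mul, hW.integral_mul, hw, inner_add_right,
      real_inner_smul_right, real_inner_smul_right, sub_self]
  have hsq : ∫ ω, X ω ^ 2 ∂P = 0 := by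
    have hi : ∀ y : L2 𝒟, Integrable (fun ω => W y ω * X ω) P := fun y =>
      (hW.memLp y).integrable_mul hXm
    have h : (fun ω => X ω ^ 2) = fun ω =>
        W w ω * X ω - (a * (W u ω * X ω) + b * (W v ω * X ω)) := by
      funext ω; simp only [hX]; ring
    rw [h, integral_sub (hi w) (by exact ((hi u).const_mul a).add ((hi v).const_mul b)),
      integral_add ((hi u).const_mul a) ((hi v).const_mul b), integral_const_mul,
      integral_const_mul, key, key, key]
    simp
  have h0 := (integral_eq_zero_iff_of_nonneg (fun ω => sq_nonneg (X ω)) hXm.integrable_sq).1 hsq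
  filter_upwards [h0] with ω hω
  have : X ω = 0 := by simpa using hω
  simp only [hX] at this
  linarith

theorem ae_sum_smul (hW : IsWhiteNoise W P) {κ : Type*} (s : Finset κ) (c : κ → ℝ)
    (v : κ → L2 𝒟) : W (∑ i ∈ s, c i • v i) =ᵐ[P] fun ω => ∑ i ∈ s, c i * W (v i) ω := by
  classical
  induction s using Finset.induction_on with
  | empty => simpa using hW.ae_linear_comb 0 0 0 0
  | insert i s hi ih =>
    have h := hW.ae_linear_comb (c i) 1 (v i) (∑ j ∈ s, c j • v j)
    filter_upwards [h, ih] with ω h1 h2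
    rw [Finset.sum_insert hi, Finset.sum_insert hi, ← h2]
    simpa using h1

theorem ae_sub (hW : IsWhiteNoise W P) (u v : L2 𝒟) :
    W (u - v) =ᵐ[P] fun ω => W u ω - W v ω := by
  filter_upwards [hW.ae_linear_comb 1 (-1) u v] with ω h
  simpa [sub_eq_add_neg] using h

/-- Gaussian tail bound for the white noise. -/
theorem measure_lt_le (hW : IsWhiteNoise W P) (u : L2 𝒟) {x : ℝ} (hx : 0 ≤ x) :
    P {ω | ‖u‖ * x < W u ω} ≤ ENNReal.ofReal (Real.exp (-(x ^ 2 / 2))) := by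
  have := hW.isGaussianProcess.isProbabilityMeasure
  have hsub : HasSubgaussianMGF (W u) (‖u‖ ^ 2).toNNReal P := by
    refine ⟨fun t => ?_, fun t => ?_⟩
    · by_contra h
      have h1 := mgf_gaussianReal (hW.map_eq_gaussianReal u) t
      rw [mgf_undef h] at h1
      exact (Real.exp_pos _).ne h1
    · rw [mgf_gaussianReal (hW.map_eq_gaussianReal u) t]
      simp
  -- For u = 0 the Chernoff exponent degenerates; the event is null because W 0 = 0 almost surely
  -- and the inequality is strict.
  rcases eq_or_ne u 0 with rfl | hu
  · have h0 := hW.ae_linear_comb 0 0 (0 : L2 𝒟) 0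
    have : P {ω | ‖(0 : L2 𝒟)‖ * x < W 0 ω} = 0 := by
      refine measure_mono_null (t := {ω | ¬ W ((0 : ℝ) • 0 + (0 : ℝ) • 0) ω = 0 * W 0 ω + 0 * W 0 ω})
        (fun ω hω => ?_) (ae_iff.1 h0)
      simp only [norm_zero, zero_mul, Set.mem_ofPred_eq] at hω
      simpa using hω.ne'
    rw [this]; exact zero_le
  · have h1 := hsub.measure_ge_le (ε := ‖u‖ * x) (by positivity)
    have h2 : -(‖u‖ * x) ^ 2 / (2 * ((‖u‖ ^ 2).toNNReal : ℝ)) = -(x ^ 2 / 2) := by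
      have : ‖u‖ ≠ 0 := norm_ne_zero_iff.2 hu
      rw [Real.coe_toNNReal _ (by positivity)]
      field_simp
    rw [h2] at h1
    calc P {ω | ‖u‖ * x < W u ω} ≤ P {ω | ‖u‖ * x ≤ W u ω} :=
          measure_mono (Set.ofPred_subset_ofPred.2 fun ω hω => le_of_lt hω)
      _ = ENNReal.ofReal (P.real {ω | ‖u‖ * x ≤ W u ω}) := by simp
      _ ≤ _ := ENNReal.ofReal_le_ofReal h1

end IsWhiteNoise

/-- Dominated convergence: the integrand tends to 0 off the origin, which a Gaussian law does not
charge. -/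
theorem exists_integral_exp_neg_mul_sq_le {η : ℝ} (hη : 0 < η) :
    ∃ T : ℝ, 0 < T ∧ ∫ x, Real.exp (-T * x ^ 2) ∂(gaussianReal 0 1) ≤ η := by
  have hlim : Tendsto (fun k : ℕ => ∫ x, Real.exp (-(k : ℝ) * x ^ 2) ∂(gaussianReal 0 1)) atTop
      (𝓝 (∫ _, (0 : ℝ) ∂(gaussianReal 0 1))) := by
    refine tendsto_integral_of_dominated_convergence (fun _ => 1)
      (fun k => by fun_prop) (integrable_const _) (fun k => ?_) ?_
    · refine Eventually.of_forall fun x => ?_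
      rw [Real.norm_eq_abs, Real.abs_exp, Real.exp_le_one_iff]
      have : 0 ≤ (k : ℝ) * x ^ 2 := by positivity
      linarith
    · have := nullSingletonClass_gaussianReal (μ := 0) (v := 1) one_ne_zero
      filter_upwards [measure_eq_zero_iff_ae_notMem.1 (measure_singleton (μ := gaussianReal 0 1) 0)]
        with x hx
      have hx2 : 0 < x ^ 2 := by
        have : x ≠ 0 := hx
        positivity
      refine Real.tendsto_exp_atBot.comp ?_
      have := (tendsto_natCast_atTop_atTop (R := ℝ)).atTop_mul_const hx2
      simp only [neg_mul]
      exact tendsto_neg_atTop_atBot.comp this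
  rw [integral_zero] at hlim
  obtain ⟨k, hk, hk1⟩ := ((hlim.eventually (ge_mem_nhds hη)).and (eventually_ge_atTop 1)).exists
  exact ⟨k, by exact_mod_cast hk1, hk⟩

/-- Small deviations of `χ²` variables: the probability that the average square of a Gaussian
vector falls below a small level decays at any prescribed exponential rate. -/
theorem exists_measure_sum_sq_lt_le (K : ℝ) :
    ∃ c : ℝ, 0 < c ∧ ∀ {𝒟 : Set ℝ} {Ω : Type*} [MeasurableSpace Ω] {P : Measure Ω}
      {W : L2 𝒟 → Ω → ℝ}, IsWhiteNoise W P → ∀ (k : ℕ) (v : Fin k → L2 𝒟), Orthonormal ℝ v →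
      P {ω | ∑ i, W (v i) ω ^ 2 < c * k} ≤ ENNReal.ofReal (Real.exp (-(K * k))) := by
  -- Chernoff at level k/T costs a factor e^k; the extra 1 in K + 1 pays for it.
  obtain ⟨T, hT, hTη⟩ := exists_integral_exp_neg_mul_sq_le (Real.exp_pos (-(K + 1)))
  refine ⟨1 / T, by positivity, ?_⟩
  intro 𝒟 Ω _ P W hW k v hv
  have := hW.isGaussianProcess.isProbabilityMeasure
  have hind : iIndepFun (fun i => W (v i)) P := by
    refine HasGaussianLaw.iIndepFun_of_covariance_eq_zero ?_ fun i j hij => ?_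
    · classical
      have := (hW.isGaussianProcess.comp_right v).hasGaussianLaw Finset.univ
      let L : (↥(Finset.univ : Finset (Fin k)) → ℝ) →L[ℝ] (Fin k → ℝ) :=
        ContinuousLinearMap.pi fun i => ContinuousLinearMap.proj ⟨i, Finset.mem_univ i⟩
      exact this.map L
    · rw [hW.covariance_eq, hv.2 hij]
  have hind2 : iIndepFun (fun i ω => W (v i) ω ^ 2) P :=
    hind.comp (fun _ x => x ^ 2) fun _ => by fun_prop
  have hmeas : ∀ i, AEMeasurable (fun ω => W (v i) ω ^ 2) P := fun i =>
    (hW.memLp (v i)).aemeasurable.pow_const 2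
  have hmgf1 : ∀ i, mgf (fun ω => W (v i) ω ^ 2) P (-T) ≤ Real.exp (-(K + 1)) := by
    intro i
    have hmap : P.map (W (v i)) = gaussianReal 0 1 := by
      rw [hW.map_eq_gaussianReal, hv.1 i]; simp
    refine le_trans (le_of_eq ?_) hTη
    rw [← hmap, integral_map (hW.memLp (v i)).aemeasurable (by fun_prop)]
    rfl
  have hmgf : mgf (∑ i, fun ω => W (v i) ω ^ 2) P (-T) ≤ Real.exp (-(K + 1)) ^ k := by
    rw [hind2.mgf_sum₀ hmeas]
    calc _ ≤ ∏ _i : Fin k, Real.exp (-(K + 1)) :=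
          Finset.prod_le_prod (fun i _ => mgf_nonneg) fun i _ => hmgf1 i
      _ = _ := by simp
  have hint : Integrable (fun ω => Real.exp (-T * (∑ i, fun ω => W (v i) ω ^ 2) ω)) P := by
    refine Integrable.mono' (integrable_const 1) ?_ (Eventually.of_forall fun ω => ?_)
    · have : AEMeasurable (∑ i, fun ω => W (v i) ω ^ 2) P :=
        Finset.aemeasurable_sum _ fun i _ => hmeas i
      exact (Real.measurable_exp.comp_aemeasurable (this.const_mul _)).aestronglyMeasurable
    · rw [Real.norm_eq_abs, Real.abs_exp, Real.exp_le_one_iff, Finset.sum_apply]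
      have : 0 ≤ T * ∑ i, W (v i) ω ^ 2 := by positivity
      linarith
  have h1 := measure_le_le_exp_mul_mgf (μ := P) (1 / T * k) (neg_nonpos.2 hT.le) hint
  calc P {ω | ∑ i, W (v i) ω ^ 2 < 1 / T * k}
      ≤ P {ω | (∑ i, fun ω => W (v i) ω ^ 2) ω ≤ 1 / T * k} :=
        measure_mono fun ω hω => by
          simp only [Set.mem_ofPred_eq, Finset.sum_apply] at hω ⊢
          exact hω.le
    _ = ENNReal.ofReal (P.real {ω | (∑ i, fun ω => W (v i) ω ^ 2) ω ≤ 1 / T * k}) := by simp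
    _ ≤ _ := by
      refine ENNReal.ofReal_le_ofReal (h1.trans ?_)
      calc _ ≤ Real.exp (- -T * (1 / T * k)) * Real.exp (-(K + 1)) ^ k := by gcongr
        _ = Real.exp (-(K * k)) := by
          rw [← Real.exp_nat_mul, ← Real.exp_add]
          congr 1
          field_simp
          ring

end Noise

/-- Markov's inequality without measurability of f or B, as the selection rule is an arbitrary
function of ω. A measurable hull of B has the same measure and suffices. -/
theorem exists_notMem_le_of_lintegral_lt {Ω : Type*} [MeasurableSpace Ω] {P : Measure Ω}
    [IsProbabilityMeasure P] {f : Ω → ℝ≥0∞} {B : Set Ω} {K : ℝ≥0∞}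
    (h : ∫⁻ ω, f ω ∂P < K * (1 - P B)) : ∃ ω, ω ∉ B ∧ f ω ≤ K := by
  by_contra! hcon
  refine h.not_ge ?_
  have hm : MeasurableSet (toMeasurable P B)ᶜ := (measurableSet_toMeasurable P B).compl
  rw [← measure_toMeasurable, ← prob_compl_eq_one_sub (measurableSet_toMeasurable P B),
    ← lintegral_indicator_const hm]
  refine lintegral_mono fun ω => ?_
  by_cases hω : ω ∈ (toMeasurable P B)ᶜ
  · rw [Set.indicator_of_mem hω]
    exact (hcon ω fun h => hω (subset_toMeasurable P B h)).le
  · rw [Set.indicator_of_notMem hω]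
    exact zero_le

/-! ### Pathwise decomposition of the loss and of the criterion. -/

section Estimator

variable {𝒟 : Set ℝ} {ι : Type*} {Φ : ι → L2 𝒟} {Ω : Type*}

/-- The projection `∑ᵢ W(eᵢ) eᵢ` of the white noise onto a model. -/
noncomputable def noise (W : L2 𝒟 → Ω → ℝ) (e : BasisChoice Φ) (m : Model Φ) (ω : Ω) : m.space :=
  ∑ i, W (e m i : L2 𝒟) ω • e m i

variable (W : L2 𝒟 → Ω → ℝ) (e : BasisChoice Φ) (s : L2 𝒟) (n : ℕ) (m : Model Φ) (ω : Ω)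

theorem norm_noise_sq : ‖noise W e m ω‖ ^ 2 = ∑ i, W (e m i : L2 𝒟) ω ^ 2 := by
  rw [← real_inner_self_eq_norm_sq, noise, (e m).orthonormal.inner_sum]
  simp [sq]

theorem Model.proj_eq_sum : m.proj s = ∑ i, ⟪(e m i : L2 𝒟), s⟫_ℝ • (e m i : L2 𝒟) := by
  rw [Model.proj, Submodule.starProjection_apply, (e m).orthogonalProjectionOnto_apply_eq_sum,
    Submodule.coe_sum]
  rfl

theorem coe_estimator_eq :
    (estimator W e s n m ω : L2 𝒟) = m.proj s + (1 / √(n : ℝ)) • (noise W e m ω : L2 𝒟) := by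
  rw [m.proj_eq_sum e, noise, estimator, Submodule.coe_sum, Submodule.coe_sum, Finset.smul_sum,
    ← Finset.sum_add_distrib]
  refine Finset.sum_congr rfl fun i _ => ?_
  rw [Submodule.coe_smul, Submodule.coe_smul, observation, setIntegral_mul_eq_inner, add_smul,
    smul_smul]

theorem Model.inner_proj_sub {x : L2 𝒟} (hx : x ∈ m.space) : ⟪x, m.proj s - s⟫_ℝ = 0 := by
  rw [real_inner_comm, ← neg_sub, inner_neg_left, neg_eq_zero]
  exact Submodule.starProjection_inner_eq_zero s x hx

theorem Model.norm_proj_sq : ‖m.proj s‖ ^ 2 = ‖s‖ ^ 2 - ‖m.proj s - s‖ ^ 2 := by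
  have h := m.inner_proj_sub s (Submodule.starProjection_apply_mem m.space s)
  have h2 := norm_sub_sq_real (m.proj s) (m.proj s - s)
  rw [Model.proj] at h2 ⊢
  rw [Model.proj] at h
  rw [h, sub_sub_cancel] at h2
  linarith

/-- Pythagoras: the noise lies in m and the bias is orthogonal to m. With no cross term, a bound on
the loss at one ω bounds the bias and the noise energy separately. -/
theorem norm_estimator_sub_sq :
    ‖(estimator W e s n m ω : L2 𝒟) - s‖ ^ 2 =
      ‖m.proj s - s‖ ^ 2 + ‖noise W e m ω‖ ^ 2 / n := by
  have h := m.inner_proj_sub s (noise W e m ω).2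
  rw [coe_estimator_eq, show m.proj s + (1 / √(n : ℝ)) • (noise W e m ω : L2 𝒟) - s =
    (m.proj s - s) + (1 / √(n : ℝ)) • (noise W e m ω : L2 𝒟) by abel, norm_add_sq_real,
    real_inner_smul_right, real_inner_comm, h, norm_smul, mul_pow, Real.norm_eq_abs, sq_abs,
    div_pow, one_pow, Real.sq_sqrt (Nat.cast_nonneg n), Submodule.coe_norm]
  ring

theorem norm_estimator_sq :
    ‖estimator W e s n m ω‖ ^ 2 = ‖s‖ ^ 2 - ‖m.proj s - s‖ ^ 2 +
      2 / √(n : ℝ) * ⟪(noise W e m ω : L2 𝒟), s⟫_ℝ + ‖noise W e m ω‖ ^ 2 / n := by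
  have h := m.inner_proj_sub s (noise W e m ω).2
  rw [inner_sub_right, sub_eq_zero] at h
  rw [Submodule.coe_norm, coe_estimator_eq, norm_add_sq_real, m.norm_proj_sq,
    real_inner_smul_right, real_inner_comm, h, norm_smul, mul_pow, Real.norm_eq_abs, sq_abs,
    div_pow, one_pow, Real.sq_sqrt (Nat.cast_nonneg n), Submodule.coe_norm]
  ring

theorem criterion_eq (lam : ℕ → ℝ) :
    criterion lam W e s n m ω = ‖m.proj s - s‖ ^ 2 + lam n / n * m.dim - ‖s‖ ^ 2 -
      2 / √(n : ℝ) * ⟪(noise W e m ω : L2 𝒟), s⟫_ℝ - ‖noise W e m ω‖ ^ 2 / n := by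
  rw [criterion, contrast_eq, sub_self, norm_zero, norm_estimator_sq]
  ring

-- Turns the random cross term of the criterion into W at the projection, so that models are
-- compared through differences of W.
variable {W} in
theorem IsWhiteNoise.ae_proj_eq [MeasurableSpace Ω] {P : Measure Ω} (hW : IsWhiteNoise W P) :
    ∀ᵐ ω ∂P, W (m.proj s) ω = ⟪(noise W e m ω : L2 𝒟), s⟫_ℝ := by
  rw [m.proj_eq_sum e]
  filter_upwards [hW.ae_sum_smul Finset.univ (fun i => ⟪(e m i : L2 𝒟), s⟫_ℝ)
    (fun i => (e m i : L2 𝒟))] with ω h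
  rw [h, noise, Submodule.coe_sum, sum_inner]
  refine Finset.sum_congr rfl fun i _ => ?_
  rw [Submodule.coe_smul, real_inner_smul_left, mul_comm]

end Estimator

theorem two_mul_mul_le_add_div (p q : ℝ) {t : ℝ} (ht : 0 < t) :
    2 * (p * q) ≤ t * p ^ 2 + q ^ 2 / t := by
  have h : t * p ^ 2 + q ^ 2 / t - 2 * (p * q) = (t * p - q) ^ 2 / t := by
    field_simp
    ring
  have : 0 ≤ (t * p - q) ^ 2 / t := by positivity
  linarith

/-- Strictly positive weights with a finite sum force S to be countable, which makes the union bound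
legitimate. -/
theorem measure_biUnion_le_of_tsum_le {Ω κ : Type*} [MeasurableSpace Ω] {P : Measure Ω}
    {S : Set κ} {B : κ → Set Ω} {w : κ → ℝ} (hw : ∀ m, 0 < w m) {r : ℝ}
    (hS : ∑' m : S, ENNReal.ofReal (w m) ≤ ENNReal.ofReal r)
    (hB : ∀ m ∈ S, P (B m) ≤ ENNReal.ofReal (w m)) :
    P (⋃ m ∈ S, B m) ≤ ENNReal.ofReal r := by
  have hc := Summable.countable_support_ennreal (hS.trans_lt ENNReal.ofReal_lt_top).ne
  have hsupp : (Function.support fun m : S => ENNReal.ofReal (w m)) = Set.univ := by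
    ext m; simpa using hw m
  rw [hsupp, Set.countable_univ_iff] at hc
  calc P (⋃ m ∈ S, B m) = P (⋃ m : S, B m) := by rw [Set.biUnion_eq_iUnion]
    _ ≤ ∑' m : S, P (B m) := measure_iUnion_le _
    _ ≤ ∑' m : S, ENNReal.ofReal (w m) := ENNReal.tsum_le_tsum fun m => hB m m.2
    _ ≤ _ := hS

/-! ### Consequences of a risk bound for the selected model. -/

section Selection

variable {𝒟 : Set ℝ} {ι : Type*} {Φ : ι → L2 𝒟} {Ω : Type*} [MeasurableSpace Ω] {P : Measure Ω}
  [IsProbabilityMeasure P] {W : L2 𝒟 → Ω → ℝ} {e : BasisChoice Φ} {M : ℕ → Set (Model Φ)}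
  {lam : ℕ → ℝ} {s : L2 𝒟} {mhat : ℕ → Ω → Model Φ} {n : ℕ}

/-- Outside an exceptional event of probability bounded away from `1`, the loss is bounded
by a multiple of the risk while the selection rule is effective. -/
theorem IsSelection.exists_loss_le (hsel : IsSelection P M lam W e s mhat) (hn : 1 ≤ n)
    {B : Set Ω} {r b : ℝ} (hr : 0 ≤ r) (hb : 0 ≤ b) (hB : P B ≤ ENNReal.ofReal r)
    (hrisk : risk P W e s mhat n < ENNReal.ofReal (b * (1 - r))) :
    ∃ ω, ω ∉ B ∧ mhat n ω ∈ M n ∧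
      (∀ m ∈ M n, criterion lam W e s n (mhat n ω) ω ≤ criterion lam W e s n m ω) ∧
      ‖(mhat n ω).proj s - s‖ ^ 2 + ‖noise W e (mhat n ω) ω‖ ^ 2 / n ≤ b := by
  set N := {ω | ¬ (mhat n ω ∈ M n ∧
    ∀ m ∈ M n, criterion lam W e s n (mhat n ω) ω ≤ criterion lam W e s n m ω)} with hN
  have hN0 : P N = 0 := ae_iff.1 (hsel n hn)
  have hBN : P (B ∪ N) ≤ ENNReal.ofReal r :=
    (measure_union_le _ _).trans (by rw [hN0, add_zero]; exact hB)
  obtain ⟨ω, hω, hle⟩ := exists_notMem_le_of_lintegral_lt (P := P) (B := B ∪ N)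
    (K := ENNReal.ofReal b) (hrisk.trans_le (by
      rw [ENNReal.ofReal_mul hb, ENNReal.ofReal_sub _ hr, ENNReal.ofReal_one]
      gcongr))
  rw [Set.mem_union, not_or] at hω
  have h2 := hω.2
  rw [hN, Set.mem_ofPred_eq, not_not] at h2
  refine ⟨ω, hω.1, h2.1, h2.2, ?_⟩
  rw [← norm_estimator_sub_sq]
  exact (ENNReal.ofReal_le_ofReal_iff hb).1 hle

/-- A bounded risk forces the existence of a model with small bias whose dimension is controlled
by the variance of the selected estimator. -/
theorem IsSelection.exists_bias_add_variance_le
    (hsel : IsSelection P M lam W e s mhat) (hn : 1 ≤ n) {S : Set (Model Φ)} (hS : M n ⊆ S)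
    {K c r b : ℝ} (hr : 0 ≤ r) (hb : 0 ≤ b)
    (hkraft : ∑' m : S, ENNReal.ofReal (Real.exp (-(K * ((m : Model Φ).dim : ℝ))))
      ≤ ENNReal.ofReal r)
    (hc : ∀ (k : ℕ) (v : Fin k → L2 𝒟), Orthonormal ℝ v →
      P {ω | ∑ i, W (v i) ω ^ 2 < c * k} ≤ ENNReal.ofReal (Real.exp (-(K * k))))
    (hrisk : risk P W e s mhat n < ENNReal.ofReal (b * (1 - r))) :
    ∃ m ∈ M n, ‖m.proj s - s‖ ^ 2 + c * m.dim / n ≤ b := by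
  -- The union runs over S rather than M n, so that the summability at n₀ also serves for smaller n.
  have hB := measure_biUnion_le_of_tsum_le (P := P) (S := S)
    (B := fun m => {ω | ∑ i, W (e m i : L2 𝒟) ω ^ 2 < c * m.dim})
    (w := fun m => Real.exp (-(K * (m.dim : ℝ)))) (fun m => Real.exp_pos _) hkraft
    fun m _ => hc m.dim (fun i => (e m i : L2 𝒟))
      ((e m).orthonormal.comp_linearIsometry m.space.subtypeₗᵢ)
  obtain ⟨ω, hω, hmem, -, hle⟩ := hsel.exists_loss_le hn hr hb hB hrisk
  refine ⟨mhat n ω, hmem, le_trans ?_ hle⟩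
  have h : c * (mhat n ω).dim ≤ ‖noise W e (mhat n ω) ω‖ ^ 2 := by
    rw [norm_noise_sq]
    by_contra! hlt
    exact hω (Set.mem_biUnion (hS hmem) hlt)
  gcongr

/-- The dimension of the selected model is at most, up to a small relative error and a multiple
of the risk, the one that is prescribed by any competitor. -/
theorem IsSelection.exists_dim_le (hW : IsWhiteNoise W P)
    (hsel : IsSelection P M lam W e s mhat) (hn : 1 ≤ n) {x κ ε η T r b : ℝ}
    (hx : 0 ≤ x) (hκ : 0 < κ) (hxκ : x ^ 2 ≤ κ * lam n) (hε : 0 < ε) (hT : 0 ≤ T)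
    (hη : Real.exp (-(T ^ 2 / 2)) ≤ η) (hr : 0 ≤ r) (hb : 0 ≤ b)
    (hkraft : ∑' m : M n, ENNReal.ofReal (Real.exp (-(x ^ 2 * ((m : Model Φ).dim : ℝ) / 2)))
      ≤ ENNReal.ofReal r)
    (hrisk : risk P W e s mhat n < ENNReal.ofReal (b * (1 - (r + η))))
    {m₀ : Model Φ} (hm₀ : m₀ ∈ M n) :
    ∃ m ∈ M n, ‖m.proj s - s‖ ^ 2 ≤ b ∧
      (1 - ε) * (lam n / n * m.dim) ≤ (1 + ε) * (‖m₀.proj s - s‖ ^ 2 + lam n / n * m₀.dim) +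
        (1 + κ / ε) * b + T ^ 2 / ε * (1 / n) := by
  have hD : ∀ m : Model Φ, 0 ≤ x * √(m.dim : ℝ) := fun m => by positivity
  -- W s is a common reference: W(s_m) - W(s_{m₀}) = W(s_m - s) + W(s - s_{m₀}). Only the first term
  -- needs a union bound over models; the second involves one fixed Gaussian variable.
  have hB₁ := measure_biUnion_le_of_tsum_le (P := P) (S := M n)
    (B := fun m => {ω | ‖m.proj s - s‖ * (x * √(m.dim : ℝ)) <
      ⟪(noise W e m ω : L2 𝒟), s⟫_ℝ - W s ω})
    (w := fun m => Real.exp (-(x ^ 2 * (m.dim : ℝ) / 2))) (fun m => Real.exp_pos _) hkraft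
    fun m _ => by
      have h := hW.measure_lt_le (m.proj s - s) (hD m)
      rw [mul_pow, Real.sq_sqrt (Nat.cast_nonneg _)] at h
      refine (measure_mono_ae ?_).trans h
      filter_upwards [hW.ae_sub (m.proj s) s, hW.ae_proj_eq e s m] with ω h1 h2 hω
      change _ < _ at hω
      change _ < _
      rwa [h1, h2]
  have hB₂ : P {ω | ‖m₀.proj s - s‖ * T < W s ω - ⟪(noise W e m₀ ω : L2 𝒟), s⟫_ℝ} ≤
      ENNReal.ofReal η := by
    refine (measure_mono_ae ?_).trans
      ((hW.measure_lt_le (s - m₀.proj s) hT).trans (ENNReal.ofReal_le_ofReal hη))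
    filter_upwards [hW.ae_sub s (m₀.proj s), hW.ae_proj_eq e s m₀] with ω h1 h2 hω
    change _ < _ at hω
    change _ < _
    rwa [h1, h2, norm_sub_rev]
  have hη0 : 0 ≤ η := (Real.exp_pos _).le.trans hη
  obtain ⟨ω, hω, hmem, hmin, hle⟩ := hsel.exists_loss_le hn (add_nonneg hr hη0) hb
    ((measure_union_le _ _).trans ((add_le_add hB₁ hB₂).trans_eq
      (ENNReal.ofReal_add hr hη0).symm)) hrisk
  rw [Set.mem_union, not_or] at hω
  set m := mhat n ω with hm
  have h1 : ⟪(noise W e m ω : L2 𝒟), s⟫_ℝ - W s ω ≤ ‖m.proj s - s‖ * (x * √(m.dim : ℝ)) := by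
    by_contra! hlt
    exact hω.1 (Set.mem_biUnion hmem hlt)
  have h2 : W s ω - ⟪(noise W e m₀ ω : L2 𝒟), s⟫_ℝ ≤ ‖m₀.proj s - s‖ * T := by
    by_contra! hlt
    exact hω.2 hlt
  have h3 := hmin m₀ hm₀
  rw [criterion_eq, criterion_eq] at h3
  have hn0 : (0 : ℝ) < n := by exact_mod_cast hn
  have hN : 0 ≤ ‖noise W e m ω‖ ^ 2 / n := by positivity
  have hN₀ : 0 ≤ ‖noise W e m₀ ω‖ ^ 2 / n := by positivity
  have hbias : ‖m.proj s - s‖ ^ 2 ≤ b := by linarith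
  refine ⟨m, hmem, hbias, ?_⟩
  have hq : 0 < √(n : ℝ) := Real.sqrt_pos.2 hn0
  have hqn : √(n : ℝ) ^ 2 = n := Real.sq_sqrt hn0.le
  have hDq : √(m.dim : ℝ) ^ 2 = m.dim := Real.sq_sqrt (Nat.cast_nonneg _)
  have hlam : 0 ≤ lam n := nonneg_of_mul_nonneg_right ((sq_nonneg x).trans hxκ) hκ
  have hD₀ : 0 ≤ lam n / n * m₀.dim := by positivity
  have h4 : 2 / √(n : ℝ) * (⟪(noise W e m ω : L2 𝒟), s⟫_ℝ - ⟪(noise W e m₀ ω : L2 𝒟), s⟫_ℝ) ≤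
      2 / √(n : ℝ) * (‖m.proj s - s‖ * (x * √(m.dim : ℝ)) + ‖m₀.proj s - s‖ * T) :=
    mul_le_mul_of_nonneg_left (by linarith) (by positivity)
  have h5 := two_mul_mul_le_add_div (x * √(m.dim : ℝ) / √(n : ℝ)) ‖m.proj s - s‖ (div_pos hε hκ)
  have h6 : ε / κ * (x * √(m.dim : ℝ) / √(n : ℝ)) ^ 2 ≤ ε * (lam n / n * m.dim) := by
    rw [div_pow, mul_pow, hqn, hDq]
    calc ε / κ * (x ^ 2 * m.dim / n) ≤ ε / κ * (κ * lam n * m.dim / n) := by gcongr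
      _ = ε * (lam n / n * m.dim) := by field_simp
  have h7 : ‖m.proj s - s‖ ^ 2 / (ε / κ) ≤ κ / ε * b := by
    calc ‖m.proj s - s‖ ^ 2 / (ε / κ) = κ / ε * ‖m.proj s - s‖ ^ 2 := by field_simp
      _ ≤ _ := by gcongr
  have h8 := two_mul_mul_le_add_div ‖m₀.proj s - s‖ (T / √(n : ℝ)) hε
  rw [div_pow, hqn, div_div, show T ^ 2 / (n * ε) = T ^ 2 / ε * (1 / n) by field_simp] at h8
  have h9 : 2 / √(n : ℝ) * (‖m.proj s - s‖ * (x * √(m.dim : ℝ)) + ‖m₀.proj s - s‖ * T) =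
      2 * (x * √(m.dim : ℝ) / √(n : ℝ) * ‖m.proj s - s‖) +
        2 * (‖m₀.proj s - s‖ * (T / √(n : ℝ))) := by ring
  have h10 : 0 ≤ ε * (lam n / n * m₀.dim) := by positivity
  -- The noise energy of the selected model, which favours large models in the criterion, is bounded
  -- by the loss through `hle`; that of m₀ has the favourable sign and is dropped.
  linarith [sq_nonneg ‖m.proj s - s‖]

end Selection

/-! ### The rate and the contraction under doubling. -/

section Rate

variable {lam : ℕ → ℝ} {α : ℝ} {n : ℕ}

theorem rate_sq (h : 0 ≤ lam n / n) : rate lam α n ^ 2 = (lam n / n) ^ (2 * α / (1 + 2 * α)) := by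
  rw [rate, ← Real.rpow_natCast, ← Real.rpow_mul h]
  congr 1
  push_cast
  ring

theorem scaledSup_le_iff {a : ℕ → ℝ≥0∞} {C : ℝ} (hC : 0 ≤ C)
    (hrate : ∀ n, 1 ≤ n → 0 < rate lam α n ^ 2) :
    scaledSup lam α a ≤ ENNReal.ofReal C ↔
      ∀ n, 1 ≤ n → a n ≤ ENNReal.ofReal (C * rate lam α n ^ 2) := by
  simp only [scaledSup, iSup_le_iff]
  refine forall₂_congr fun n hn => ?_
  have h := hrate n hn
  rw [ENNReal.ofReal_inv_of_pos h, ENNReal.ofReal_mul hC,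
    ENNReal.inv_mul_le_iff (ENNReal.ofReal_pos.2 h).ne' ENNReal.ofReal_ne_top, mul_comm]

end Rate

/-- The contraction behind the comparison of a sample size with its double. -/
theorem mul_add_le_mul_rpow {β δ x τ ε K F y z : ℝ} (hβ₀ : 0 < β) (hβ₁ : β < 1)
    (hδ₀ : 0 < δ) (hx₀ : 1 / 2 ≤ x) (hx₁ : x ≤ 1 - δ) (hτ : τ = (1 - δ) ^ (1 - β))
    (hε : ε = (1 - τ) / (1 + 3 * τ)) (hF : 0 ≤ F) (hK : 4 * (z + F / (1 - ε)) / (1 - τ) ≤ K)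
    (hz : 0 ≤ z) (hy : (1 - ε) * y ≤ (1 + ε) * K + F) : z + x * y ≤ K * x ^ β := by
  have hδ₁ : 0 < 1 - δ := by linarith
  have hx : 0 < x := by linarith
  have hτ₀ : 0 < τ := hτ ▸ Real.rpow_pos_of_pos hδ₁ _
  have hτ₁ : τ < 1 := hτ ▸ Real.rpow_lt_one hδ₁.le (by linarith) (by linarith)
  have hε₁ : 1 - ε = 4 * τ / (1 + 3 * τ) := by rw [hε]; field_simp; ring
  have hε₂ : 1 + ε = 2 * (1 + τ) / (1 + 3 * τ) := by rw [hε]; field_simp; ring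
  have hpos : 0 < 1 - ε := hε₁ ▸ by positivity
  have hG : 0 ≤ z + F / (1 - ε) := by positivity
  have hK₀ : 0 ≤ K := le_trans (div_nonneg (by positivity) (by linarith)) hK
  -- The gain: x^{1-β} ≤ τ < 1.
  have hxβ : x ≤ x ^ β * τ := by
    calc x = x ^ β * x ^ (1 - β) := by rw [← Real.rpow_add hx]; simp
      _ ≤ x ^ β * τ := by
        rw [hτ]
        gcongr
  have hβ2 : 1 / 2 ≤ x ^ β := by
    have h := Real.rpow_le_rpow_of_exponent_ge hx (by linarith) hβ₁.le
    rw [Real.rpow_one] at h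
    linarith
  have hy' : y ≤ (1 + ε) / (1 - ε) * K + F / (1 - ε) := by
    rw [← mul_le_mul_iff_right₀ hpos]
    refine hy.trans_eq ?_
    field_simp
  -- The choice of ε makes τ(1+ε)/(1-ε) = (1+τ)/2. The remaining slack (1-τ)/2 absorbs z + F/(1-ε),
  -- using x^β ≥ 1/2.
  have h1 : x * ((1 + ε) / (1 - ε) * K) ≤ x ^ β * ((1 + τ) / 2) * K := by
    have : (1 + ε) / (1 - ε) = (1 + τ) / 2 / τ := by
      rw [hε₁, hε₂]; field_simp; ring
    rw [this]
    calc x * ((1 + τ) / 2 / τ * K) ≤ (x ^ β * τ) * ((1 + τ) / 2 / τ * K) := by gcongr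
      _ = _ := by field_simp
  have h2 : x * (F / (1 - ε)) ≤ F / (1 - ε) :=
    mul_le_of_le_one_left (by positivity) (by linarith)
  have h3 : 4 * (z + F / (1 - ε)) ≤ K * (1 - τ) := (div_le_iff₀ (by linarith)).1 hK
  have h4 : 1 / 2 * (K * (1 - τ)) ≤ x ^ β * (K * (1 - τ)) := by
    have : 0 ≤ K * (1 - τ) := mul_nonneg hK₀ (by linarith)
    gcongr
  have h5 : x * y ≤ x * ((1 + ε) / (1 - ε) * K + F / (1 - ε)) := by gcongr
  linarith

theorem exists_mul_two_pow_le_lt {n₀ n : ℕ} (hn₀ : 1 ≤ n₀) (hn : n₀ ≤ n) :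
    ∃ j : ℕ, n₀ * 2 ^ j ≤ n ∧ n < 2 * (n₀ * 2 ^ j) := by
  have hq : n / n₀ ≠ 0 := (Nat.div_pos hn hn₀).ne'
  refine ⟨Nat.log 2 (n / n₀), ?_, ?_⟩
  · rw [mul_comm]
    exact (Nat.le_div_iff_mul_le hn₀).1 (Nat.pow_log_le_self 2 hq)
  · have h := (Nat.div_lt_iff_lt_mul hn₀).1 (Nat.lt_pow_succ_log_self one_lt_two (n / n₀))
    rw [pow_succ] at h
    linarith

end WhiteNoise

/-! ### Choice of constants and dyadic recursion. -/

theorem mainTheorem1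
    {𝒟 : Set ℝ} (h𝒟 : MeasurableSet 𝒟)
    {ι : Type*} [Countable ι] (Φ : ι → WhiteNoise.L2 𝒟)
    {Ω : Type*} [MeasurableSpace Ω] (P : MeasureTheory.Measure Ω)
    [MeasureTheory.IsProbabilityMeasure P]
    (W : WhiteNoise.L2 𝒟 → Ω → ℝ) (hW : WhiteNoise.IsWhiteNoise W P)
    (e : WhiteNoise.BasisChoice Φ)
    (M : ℕ → Set (WhiteNoise.Model Φ)) (lam : ℕ → ℝ) (α₀ δ p : ℝ) (n₀ : ℕ)
    (hα₀ : 0 < α₀)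
    (hM : ∀ n, 1 ≤ n → M n ⊆ M (n + 1))
    (hlam_pos : ∀ n, 1 ≤ n → 0 < lam n)
    (hlam_mono : ∀ n, 1 ≤ n → lam n ≤ lam (n + 1))
    (hlam_lim : Filter.Tendsto (fun n : ℕ => (n : ℝ)⁻¹ * lam n) Filter.atTop (nhds 0))
    (hn₀ : 1 ≤ n₀) (hδ₀ : 0 < δ) (hδ : δ ≤ 1 / 2) (hp₀ : 0 < p) (hp₁ : p < 1)
    (hlam_double : ∀ n, n₀ ≤ n → lam (2 * n) ≤ 2 * (1 - δ) * lam n)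
    (hkraft : ∀ n, n₀ ≤ n →
      ∑' m : M n, ENNReal.ofReal
          (Real.exp (-((√(lam n) - 1) ^ 2 * ((m : WhiteNoise.Model Φ).dim : ℝ) / 2)))
        ≤ ENNReal.ofReal (√(1 - p)))
    (hlam_large : WhiteNoise.upsilon δ p α₀ ≤ lam n₀) :
    ∀ α : ℝ, 0 < α → α ≤ α₀ → ∀ R : ℝ, 0 < R → ∃ R' : ℝ, 0 < R' ∧
      ∀ (s : WhiteNoise.L2 𝒟) (mhat : ℕ → Ω → WhiteNoise.Model Φ),
        WhiteNoise.IsSelection P M lam W e s mhat →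
        WhiteNoise.scaledSup lam α (WhiteNoise.risk P W e s mhat) ≤ ENNReal.ofReal (R ^ 2) →
        WhiteNoise.scaledSup lam α (WhiteNoise.Q M lam s) ≤ ENNReal.ofReal (R' ^ 2) := by
  intro α hα₁ _ R hR
  have hmono : ∀ m n, 1 ≤ m → m ≤ n → lam m ≤ lam n := by
    intro m n hm hmn
    induction n, hmn using Nat.le_induction with
    | base => exact le_rfl
    | succ k hk ih => exact ih.trans (hlam_mono k (hm.trans hk))
  have hMmono : ∀ m n, 1 ≤ m → m ≤ n → M m ⊆ M n := by
    intro m n hm hmn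
    induction n, hmn using Nat.le_induction with
    | base => exact le_rfl
    | succ k hk ih => exact ih.trans (hM k (hm.trans hk))
  have ha : ∀ n, 1 ≤ n → 0 < lam n / n := fun n hn =>
    div_pos (hlam_pos n hn) (by exact_mod_cast hn)
  set β := 2 * α / (1 + 2 * α) with hβ
  have hβ₀ : 0 < β := by positivity
  have hβ₁ : β < 1 := by rw [hβ, div_lt_one (by positivity)]; linarith
  have hrate : ∀ n, 1 ≤ n → WhiteNoise.rate lam α n ^ 2 = (lam n / n) ^ β := fun n hn =>
    WhiteNoise.rate_sq (ha n hn).le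
  have hrate_pos : ∀ n, 1 ≤ n → 0 < WhiteNoise.rate lam α n ^ 2 := fun n hn => by
    rw [hrate n hn]; exact Real.rpow_pos_of_pos (ha n hn) _
  have hlam1 := hlam_pos 1 le_rfl
  obtain ⟨A, hA⟩ := hlam_lim.bddAbove_range
  replace hA : ∀ n : ℕ, lam n / n ≤ A := fun n => by
    have := hA (Set.mem_range_self n)
    rwa [← div_eq_inv_mul] at this
  -- The parametric term 1/n is of the order of the squared rate: λ_n ≥ λ_1, and a = a^{1-β} a^β
  -- with a = λ_n/n ≤ A.
  have hinv : ∀ n : ℕ, 1 ≤ n →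
      1 / (n : ℝ) ≤ A ^ (1 - β) / lam 1 * WhiteNoise.rate lam α n ^ 2 := by
    intro n hn
    have hn' : (0 : ℝ) < n := by exact_mod_cast hn
    have hβ' : 0 ≤ 1 - β := by linarith
    calc 1 / (n : ℝ) = lam 1 / n / lam 1 := by field_simp
      _ ≤ lam n / n / lam 1 := by
        have := hmono 1 n le_rfl hn
        gcongr
      _ = (lam n / n) ^ (1 - β) * (lam n / n) ^ β / lam 1 := by
        rw [← Real.rpow_add (ha n hn)]; simp
      _ ≤ A ^ (1 - β) * (lam n / n) ^ β / lam 1 := by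
        have := hA n
        have := ha n hn
        gcongr
      _ = _ := by rw [hrate n hn]; ring
  -- the exceptional probabilities
  set r := √(1 - p) with hr
  have hr₀ : 0 ≤ r := Real.sqrt_nonneg _
  have hr₁ : r < 1 := by
    rw [hr, Real.sqrt_lt' one_pos]
    linarith
  set η := (1 - r) / 2 with hη
  have hη₀ : 0 < η := by linarith
  set T := √(-(2 * Real.log η)) with hT
  have hTη : Real.exp (-(T ^ 2 / 2)) ≤ η := by
    have : Real.log η ≤ 0 := Real.log_nonpos hη₀.le (by linarith)
    rw [hT, Real.sq_sqrt (by linarith), show -(-(2 * Real.log η) / 2) = Real.log η by ring,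
      Real.exp_log hη₀]
  -- The decay rate matches the weights of the summability condition at n₀.
  obtain ⟨c, hc, hchi⟩ := WhiteNoise.exists_measure_sum_sq_lt_le ((√(lam n₀) - 1) ^ 2 / 2)
  -- the constants of the recursion
  set B := 4 * R ^ 2 / (1 - r) with hB
  have h1r : 0 < 1 - r := by linarith
  have hB₀ : 0 < B := by positivity
  set κ := 1 + 1 / lam 1 with hκ
  have hκ₀ : 0 < κ := by positivity
  set τ := (1 - δ) ^ (1 - β) with hτ
  have hτ₀ : 0 < τ := Real.rpow_pos_of_pos (by linarith) _
  have hτ₁ : τ < 1 := Real.rpow_lt_one (by linarith) (by linarith) (by linarith)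
  -- Solution of τ(1+ε)/(1-ε) = (1+τ)/2.
  set ε := (1 - τ) / (1 + 3 * τ) with hε
  have hε₀ : 0 < ε := div_pos (by linarith) (by linarith)
  have hε₁ : ε < 1 := by rw [hε, div_lt_one (by positivity)]; linarith
  have hA₀ : 0 < A := (ha 1 le_rfl).trans_le (hA 1)
  set F := (1 + κ / ε) * B + T ^ 2 / ε * (A ^ (1 - β) / lam 1) with hF
  have hF₀ : 0 ≤ F := by positivity
  -- The first entry starts the recursion, the second lets it reproduce itself; neither depends on
  -- s.
  set K := max ((1 + lam n₀ / c) * B) (4 * (B + F / (1 - ε)) / (1 - τ)) with hK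
  have hlam₀ := hlam_pos n₀ hn₀
  have hK₀ : 0 < K := lt_max_of_lt_left (by positivity)
  refine ⟨√(4 * K), by positivity, fun s mhat hsel hrisk => ?_⟩
  rw [Real.sq_sqrt (by positivity)]
  rw [WhiteNoise.scaledSup_le_iff (by positivity) hrate_pos] at hrisk
  rw [WhiteNoise.scaledSup_le_iff (by positivity) hrate_pos]
  have hrisk₁ : ∀ n, 1 ≤ n → WhiteNoise.risk P W e s mhat n <
      ENNReal.ofReal (B * WhiteNoise.rate lam α n ^ 2 * (1 - (r + η))) := by
    intro n hn
    have hρ := hrate_pos n hn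
    refine (hrisk n hn).trans_lt ((ENNReal.ofReal_lt_ofReal_iff_of_nonneg (by positivity)).2 ?_)
    -- Since 1 - (r + η) = (1 - r)/2, the value of B leaves a factor 2, hence strict inequality.
    have : B * WhiteNoise.rate lam α n ^ 2 * (1 - (r + η)) =
        2 * (R ^ 2 * WhiteNoise.rate lam α n ^ 2) := by
      rw [hB, hη]; field_simp; ring
    rw [this]
    have : 0 < R ^ 2 * WhiteNoise.rate lam α n ^ 2 := by positivity
    linarith
  have hrisk₂ : ∀ n, 1 ≤ n → WhiteNoise.risk P W e s mhat n <
      ENNReal.ofReal (B * WhiteNoise.rate lam α n ^ 2 * (1 - r)) := by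
    intro n hn
    have hρ := hrate_pos n hn
    refine (hrisk₁ n hn).trans_le (ENNReal.ofReal_le_ofReal ?_)
    gcongr
    linarith
  have hbase : ∀ n, 1 ≤ n → n ≤ n₀ → ∃ m ∈ M n,
      ‖m.proj s - s‖ ^ 2 + lam n / n * m.dim ≤ K * WhiteNoise.rate lam α n ^ 2 := by
    intro n hn hnn₀
    have hρ := hrate_pos n hn
    have hn' : (0 : ℝ) < n := by exact_mod_cast hn
    obtain ⟨m, hm, hle⟩ := hsel.exists_bias_add_variance_le hn (hMmono n n₀ hn hnn₀)
      (K := (√(lam n₀) - 1) ^ 2 / 2) (c := c) hr₀ (by positivity)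
      (by simpa only [div_mul_eq_mul_div] using hkraft n₀ le_rfl) (hchi hW) (hrisk₂ n hn)
    refine ⟨m, hm, ?_⟩
    calc ‖m.proj s - s‖ ^ 2 + lam n / n * m.dim
        ≤ ‖m.proj s - s‖ ^ 2 + lam n₀ / n * m.dim := by
          have := hmono n n₀ hn hnn₀
          gcongr
      _ ≤ (1 + lam n₀ / c) * (‖m.proj s - s‖ ^ 2 + c * m.dim / n) := by
          have h1 : (1 + lam n₀ / c) * (‖m.proj s - s‖ ^ 2 + c * m.dim / n) =
            ‖m.proj s - s‖ ^ 2 + lam n₀ / n * m.dim +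
              (lam n₀ / c * ‖m.proj s - s‖ ^ 2 + c * m.dim / n) := by field_simp; ring
          have h2 : 0 ≤ lam n₀ / c * ‖m.proj s - s‖ ^ 2 + c * m.dim / n := by positivity
          linarith
      _ ≤ (1 + lam n₀ / c) * (B * WhiteNoise.rate lam α n ^ 2) := by gcongr
      _ ≤ K * WhiteNoise.rate lam α n ^ 2 := by
          rw [← mul_assoc]
          gcongr
          exact le_max_left _ _
  have hstep : ∀ n, n₀ ≤ n →
      (∃ m ∈ M n, ‖m.proj s - s‖ ^ 2 + lam n / n * m.dim ≤ K * WhiteNoise.rate lam α n ^ 2) →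
      ∃ m ∈ M (2 * n), ‖m.proj s - s‖ ^ 2 + lam (2 * n) / (2 * n : ℕ) * m.dim ≤
        K * WhiteNoise.rate lam α (2 * n) ^ 2 := by
    rintro n hn ⟨m₀, hm₀, hle₀⟩
    have hn1 : 1 ≤ n := hn₀.trans hn
    have hρ := hrate_pos n hn1
    have hlamn := hlam_pos n hn1
    have hn' : (0 : ℝ) < n := by exact_mod_cast hn1
    obtain ⟨m, hm, hbias, hdim⟩ := hsel.exists_dim_le hW hn1 (x := |√(lam n) - 1|) (κ := κ)
      (ε := ε) (η := η) (T := T) (r := r) (b := B * WhiteNoise.rate lam α n ^ 2) (abs_nonneg _) hκ₀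
      (by
        rw [sq_abs, sub_sq, Real.sq_sqrt hlamn.le]
        have h1 : 1 ≤ lam n / lam 1 := (one_le_div hlam1).2 (hmono 1 n le_rfl hn1)
        have h2 : κ * lam n = lam n + lam n / lam 1 := by rw [hκ]; ring
        have h3 := Real.sqrt_nonneg (lam n)
        linarith)
      hε₀ (Real.sqrt_nonneg _) hTη hr₀ (by positivity)
      (by simpa only [sq_abs] using hkraft n hn) (hrisk₁ n hn1) hm₀
    refine ⟨m, hMmono n (2 * n) hn1 (by omega) hm, ?_⟩
    set ρ := WhiteNoise.rate lam α n ^ 2 with hρdef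
    -- Ratio of λ/n at 2n and at n: monotonicity of λ gives x ≥ 1/2, the doubling condition x ≤ 1 -
    -- δ.
    set x := lam (2 * n) / (2 * lam n) with hx
    have hx₀ : 1 / 2 ≤ x := by
      rw [hx, div_le_div_iff₀ two_pos (by positivity)]
      linarith [hmono n (2 * n) hn1 (by omega)]
    have hx₁ : x ≤ 1 - δ := by
      rw [hx, div_le_iff₀ (by positivity)]
      linarith [hlam_double n hn]
    have hax : lam (2 * n) / (2 * n : ℕ) = x * (lam n / n) := by
      rw [hx]; push_cast; field_simp
    have hρ2 : WhiteNoise.rate lam α (2 * n) ^ 2 = x ^ β * ρ := by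
      rw [hrate (2 * n) (by omega), hax, Real.mul_rpow (by linarith) (ha n hn1).le, hρdef,
        hrate n hn1]
    have hy : (1 - ε) * (lam n / n * m.dim / ρ) ≤ (1 + ε) * K + F := by
      rw [← mul_div_assoc, div_le_iff₀ hρ]
      have h1 : T ^ 2 / ε * (1 / n) ≤ T ^ 2 / ε * (A ^ (1 - β) / lam 1 * ρ) := by
        have := hinv n hn1
        gcongr
      have h2 : (1 + ε) * (‖m₀.proj s - s‖ ^ 2 + lam n / n * m₀.dim) ≤ (1 + ε) * (K * ρ) := by
        gcongr
      calc _ ≤ _ := hdim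
        _ ≤ (1 + ε) * (K * ρ) + (1 + κ / ε) * (B * ρ) +
            T ^ 2 / ε * (A ^ (1 - β) / lam 1 * ρ) := by gcongr
        _ = ((1 + ε) * K + F) * ρ := by rw [hF]; ring
    have hfin := WhiteNoise.mul_add_le_mul_rpow hβ₀ hβ₁ hδ₀ hx₀ hx₁ hτ hε hF₀
      (le_max_right _ _ : _ ≤ K) hB₀.le hy
    rw [hax, hρ2]
    calc ‖m.proj s - s‖ ^ 2 + x * (lam n / n) * m.dim
        ≤ B * ρ + x * (lam n / n) * m.dim := by gcongr
      _ = (B + x * (lam n / n * m.dim / ρ)) * ρ := by field_simp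
      _ ≤ K * x ^ β * ρ := by gcongr
      _ = _ := by ring
  have hdyadic : ∀ j : ℕ, ∃ m ∈ M (n₀ * 2 ^ j),
      ‖m.proj s - s‖ ^ 2 + lam (n₀ * 2 ^ j) / (n₀ * 2 ^ j : ℕ) * m.dim ≤
        K * WhiteNoise.rate lam α (n₀ * 2 ^ j) ^ 2 := by
    intro j
    induction j with
    | zero => simpa using hbase n₀ hn₀ le_rfl
    | succ j ih =>
      have h := hstep (n₀ * 2 ^ j) (Nat.le_mul_of_pos_right _ (by positivity)) ih
      rwa [show 2 * (n₀ * 2 ^ j) = n₀ * 2 ^ (j + 1) by ring] at h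
  intro n hn
  have hρ := hrate_pos n hn
  suffices h : ∃ m ∈ M n, ‖m.proj s - s‖ ^ 2 + lam n / n * m.dim ≤
      4 * K * WhiteNoise.rate lam α n ^ 2 by
    obtain ⟨m, hm, hle⟩ := h
    exact (iInf₂_le m hm).trans (ENNReal.ofReal_le_ofReal hle)
  rcases le_total n n₀ with hnn₀ | hnn₀
  · obtain ⟨m, hm, hle⟩ := hbase n hn hnn₀
    refine ⟨m, hm, hle.trans ?_⟩
    gcongr
    linarith
  · obtain ⟨j, hj₁, hj₂⟩ := WhiteNoise.exists_mul_two_pow_le_lt hn₀ hnn₀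
    obtain ⟨m, hm, hle⟩ := hdyadic j
    have hkn₀ : n₀ ≤ n₀ * 2 ^ j := Nat.le_mul_of_pos_right _ (by positivity)
    generalize n₀ * 2 ^ j = k at *
    have hk : 1 ≤ k := hn₀.trans hkn₀
    have hk' : (0 : ℝ) < k := by exact_mod_cast hk
    have hn' : (0 : ℝ) < n := by exact_mod_cast hn
    have hkn : (k : ℝ) ≤ n := by exact_mod_cast hj₁
    have hnk : (n : ℝ) ≤ 2 * k := by exact_mod_cast hj₂.le
    have hlamk := hlam_pos k hk
    have hlamn := hlam_pos n hn
    -- Inside a dyadic block the penalty level and the squared rate each change by a factor of at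
    -- most 2, whence the 4 in the final constant.
    have hup : lam n / n ≤ 2 * (lam k / k) := by
      have h1 : lam n ≤ 2 * lam k := by
        have h2 := hmono n (2 * k) hn hj₂.le
        have h3 := hlam_double k hkn₀
        have h4 : 0 ≤ δ * lam k := by positivity
        linarith
      calc lam n / n ≤ 2 * lam k / k := by gcongr
        _ = _ := by ring
    have hlow : lam k / k ≤ 2 * (lam n / n) := by
      have h1 := hmono k n hk hj₁
      rw [← mul_div_assoc, div_le_div_iff₀ hk' hn']
      calc lam k * n ≤ lam n * (2 * k) := by gcongr
        _ = _ := by ring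
    have hρk : WhiteNoise.rate lam α k ^ 2 ≤ 2 * WhiteNoise.rate lam α n ^ 2 := by
      rw [hrate k hk, hrate n hn]
      calc (lam k / k) ^ β ≤ (2 * (lam n / n)) ^ β := by gcongr
        _ = 2 ^ β * (lam n / n) ^ β := Real.mul_rpow two_pos.le (ha n hn).le
        _ ≤ 2 ^ (1 : ℝ) * (lam n / n) ^ β := by
          have := ha n hn
          gcongr
          exact one_le_two
        _ = _ := by rw [Real.rpow_one]
    refine ⟨m, hMmono k n hk hj₁ hm, ?_⟩
    calc ‖m.proj s - s‖ ^ 2 + lam n / n * m.dim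
        ≤ ‖m.proj s - s‖ ^ 2 + 2 * (lam k / k) * m.dim := by gcongr
      _ ≤ 2 * (‖m.proj s - s‖ ^ 2 + lam k / k * m.dim) := by
          linarith [sq_nonneg ‖m.proj s - s‖]
      _ ≤ 2 * (K * (2 * WhiteNoise.rate lam α n ^ 2)) := by
          refine mul_le_mul_of_nonneg_left (hle.trans ?_) two_pos.le
          gcongr
      _ = _ := by ring
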